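/- Let $D$ be a principal ideal domain and let $A$ be an $m\times n$ matrix over $D[x]$ of rank $r$, where the rank of a matrix over $D[x]$ is the maximal order of its non-zero minors (and is $0$ for a zero matrix). Then $A$ has a full rank factorization over $D[x]$: there are an $m\times r$ matrix $P$ and an $r\times n$ matrix $Q$ with entries in $D[x]$, both of rank $r$, such that $A=PQ$. -/

import Mathlib

open Polynomial

/-- `A` has a non-zero minor of order `k`: the minors of order `k` are the determinants of the
submatrices formed by `k` rows and `k` columns of `A`, taken in increasing order
(for `k = 0` the empty minor, equal to `1`). -/
def HasNonzeroMinor {R : Type*} [CommRing R] {m n : ℕ} (A : Matrix (Fin m) (Fin n) R)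
    (k : ℕ) : Prop :=
  ∃ (f : Fin k ↪o Fin m) (g : Fin k ↪o Fin n), (A.submatrix f g).det ≠ 0

/-- `A` has rank `r`: `r` is the maximal order of the non-zero minors of `A`.
A zero matrix has rank `0`. -/
def HasRank {R : Type*} [CommRing R] {m n : ℕ} (A : Matrix (Fin m) (Fin n) R) (r : ℕ) : Prop :=
  IsGreatest {k : ℕ | HasNonzeroMinor A k} r

/-- `A = P * Q` is a full rank factorization of `A`: `A` has rank `r`,
`P` has `r` columns and rank `r` (full column rank), and `Q` has `r` rows and rank `r`
(full row rank). -/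
structure IsFullRankFactorization {R : Type*} [CommRing R] {m n r : ℕ}
    (A : Matrix (Fin m) (Fin n) R) (P : Matrix (Fin m) (Fin r) R)
    (Q : Matrix (Fin r) (Fin n) R) : Prop where
  rank_eq : HasRank A r
  left_rank : HasRank P r
  right_rank : HasRank Q r
  eq_mul : A = P * Q

/-! Let `F` be the fraction field of `D`. Since `F[X]` is a PID, `A` factors over it with inner
dimension `r`; clearing denominators gives `C s • A = P * Q` over `D[X]` with `s ≠ 0` in `D`. The
primes of `s` are then cancelled one at a time (`exists_factorization_of_smul_eq_mul`). Modulo a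
prime `p` the ring becomes `(D/p)[X]`, which is Euclidean, so column operations that lift to `D[X]`
make the nonzero columns of `P` mod `p` independent. As `P * Q` vanishes mod `p`, for each `j`
column `j` of `P` or row `j` of `Q` is divisible by `p`, and `p` is divided out term by term. Any
factorization with inner dimension `r` has factors of rank `r`. -/

/-! ### Column reduction modulo a prime, and cancellation of constants -/

open Matrix in
theorem exists_columnOperation {R : Type*} [CommRing R] {m ι : Type*} [Fintype ι]
    [DecidableEq ι] (i : ι) (q : ι → R) (hq : q i = 0) :
    ∃ U V : Matrix ι ι R, U * V = 1 ∧ ∀ (P : Matrix m ι R) (a : m) (j : ι),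
      (P * U) a j = P a j + if j = i then ∑ k, P a k * q k else 0 := by
  set N : Matrix ι ι R := of fun k l => if l = i then q k else 0 with hN
  have hNN : N * N = 0 := by
    ext a b
    simp [hN, mul_apply, hq]
  -- `N` is supported on column `i`, and `q i = 0` makes it square to zero.
  refine ⟨1 + N, 1 - N, ?_, fun P a j => ?_⟩
  · rw [mul_sub, add_mul, add_mul, hNN]
    simp
  · rw [Matrix.mul_add, Matrix.mul_one, Matrix.add_apply, mul_apply]
    by_cases h : j = i <;> simp [hN, h]

-- Euclidean descent on a nonzero coefficient `x` of a relation among the columns mod `ker φ`: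
-- either `x` divides the whole relation and column `i` can be cleared, or a column operation leaves
-- a nonzero remainder as a smaller coefficient.
open Finset in
theorem exists_more_zero_columns {R E : Type*} [CommRing R] [EuclideanDomain E] (φ : R →+* E)
    (hφ : Function.Surjective φ) {m ι : Type*} [Fintype ι] [DecidableEq ι]
    (x : E) (P : Matrix m ι R) (c : ι → E) (hc : ∀ a, ∑ j, φ (P a j) * c j = 0) (i : ι)
    (hx : c i = x) (hx0 : x ≠ 0) (hPi : ∃ a, φ (P a i) ≠ 0)
    (hzero : ∀ j, (∀ a, φ (P a j) = 0) → c j = 0) :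
    ∃ U V : Matrix ι ι R, U * V = 1 ∧
      {j | ∀ a, φ (P a j) = 0} ⊂ {j | ∀ a, φ ((P * U) a j) = 0} := by
  induction x using (EuclideanDomain.r_wellFounded (R := E)).induction generalizing P c i with
  | _ x ih =>
  have of_zero : ∀ U V : Matrix ι ι R, U * V = 1 → (∀ a, φ ((P * U) a i) = 0) →
      (∀ j ≠ i, ∀ a, (P * U) a j = P a j) → ∃ U V : Matrix ι ι R, U * V = 1 ∧
      {j | ∀ a, φ (P a j) = 0} ⊂ {j | ∀ a, φ ((P * U) a j) = 0} := by
    intro U V hUV h1 h2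
    obtain ⟨a, ha⟩ := hPi
    refine ⟨U, V, hUV, ?_⟩
    rw [Set.ssubset_iff_of_subset]
    · exact ⟨i, h1, fun h => ha (h a)⟩
    · intro j hj b
      by_cases hji : j = i
      · exact absurd (hj a) (hji ▸ ha)
      · rw [h2 j hji]; exact hj b
  by_cases hdvd : ∀ j, x ∣ c j
  -- Dividing the relation by `x` gives coefficient `1` at `i`, so adding the multiples `d j` of the
  -- other columns kills column `i`.
  · choose d hd using hdvd
    choose q hq using fun j => hφ (if j = i then 0 else d j)
    obtain ⟨U, V, hUV, hU⟩ := exists_columnOperation (m := m) i (fun j => if j = i then 0 else q j)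
      (by simp)
    refine of_zero U V hUV (fun a => ?_) (fun j hj a => by simp [hU, hj])
    have hdi : d i = 1 := by
      have := hd i
      rw [hx] at this
      exact (mul_left_cancel₀ hx0 (by rw [← this, mul_one])).symm
    apply mul_left_cancel₀ hx0
    rw [mul_zero, ← hc a, hU, if_pos rfl, map_add, map_sum, mul_add, mul_sum,
      ← add_sum_erase _ _ (mem_univ i), ← add_sum_erase univ (fun j => φ (P a j) * c j) (mem_univ i)]
    rw [hx]
    have : ∀ j ∈ univ.erase i, x * φ (P a j * if j = i then 0 else q j) = φ (P a j) * c j := by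
      intro j hj
      have hj := ne_of_mem_erase hj
      rw [if_neg hj, map_mul, hq, if_neg hj, hd j]
      ring
    rw [sum_congr rfl this]
    simp [mul_comm]
  · push Not at hdvd
    obtain ⟨j, hj⟩ := hdvd
    have hji : j ≠ i := by rintro rfl; exact hj (hx ▸ dvd_rfl)
    -- Adding `c j / x` times column `j` to column `i` preserves the relation once `c j` is replaced
    -- by `c j % x`, the next pivot.
    obtain ⟨q, hq⟩ := hφ (c j / x)
    obtain ⟨U, V, hUV, hU⟩ := exists_columnOperation (m := m) i (Pi.single j q)
      (by simp [hji.symm])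
    have hUi : ∀ a, φ ((P * U) a i) = φ (P a i) + φ (P a j) * (c j / x) := by
      intro a
      simp [hU, Pi.single_apply, hq]
    have hUk : ∀ k ≠ i, ∀ a, (P * U) a k = P a k := fun k hk a => by simp [hU, hk]
    by_cases hz : ∀ a, φ ((P * U) a i) = 0
    · exact of_zero U V hUV hz hUk
    push Not at hz
    have hPj : ∃ a, φ (P a j) ≠ 0 := by
      by_contra! h
      exact hj (by rw [hzero j h]; exact dvd_zero _)
    have hcj : ∀ a, φ (P a j) * c j = φ (P a j) * (c j / x) * x + φ (P a j) * (c j % x) := by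
      intro a
      conv_lhs => rw [← EuclideanDomain.div_add_mod (c j) x]
      ring
    have hset : ∀ k, (∀ a, φ ((P * U) a k) = 0) ↔ ∀ a, φ (P a k) = 0 := by
      intro k
      by_cases hk : k = i
      · subst hk
        refine ⟨fun h => ?_, fun h => ?_⟩
        · exact absurd (h hz.choose) hz.choose_spec
        · exact absurd (h hPi.choose) hPi.choose_spec
      · simp [hUk k hk]
    have hc' : ∀ a, ∑ k, φ ((P * U) a k) * Function.update c j (c j % x) k = 0 := fun a => by
      rw [← hc a, ← add_sum_erase _ _ (mem_univ i),
        ← add_sum_erase univ (fun j => φ (P a j) * c j) (mem_univ i),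
        ← add_sum_erase _ _ (mem_erase.2 ⟨hji, mem_univ j⟩),
        ← add_sum_erase (univ.erase i) (fun j => φ (P a j) * c j) (mem_erase.2 ⟨hji, mem_univ j⟩)]
      have : ∀ k ∈ (univ.erase i).erase j,
          φ ((P * U) a k) * Function.update c j (c j % x) k = φ (P a k) * c k := by
        intro k hk
        simp only [mem_erase] at hk
        rw [hUk k hk.2.1, Function.update_of_ne hk.1]
      rw [sum_congr rfl this, hcj, hUi, Function.update_of_ne hji.symm, Function.update_self, hx,
        hUk j hji]
      ring
    have hzero' : ∀ k, (∀ a, φ ((P * U) a k) = 0) → Function.update c j (c j % x) k = 0 :=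
        fun k hk => by
      rw [hset] at hk
      have hkj : k ≠ j := by rintro rfl; exact hPj.choose_spec (hk _)
      rw [Function.update_of_ne hkj, hzero k hk]
    obtain ⟨U', V', hUV', hlt⟩ := ih (c j % x) (EuclideanDomain.mod_lt _ hx0) (P * U)
      (Function.update c j (c j % x)) hc' j (by simp)
      (fun h => hj ((EuclideanDomain.mod_eq_zero).1 h)) (by simpa [hUk j hji] using hPj) hzero'
    refine ⟨U * U', V' * V, ?_, ?_⟩
    · rw [Matrix.mul_assoc, ← Matrix.mul_assoc U', hUV', Matrix.one_mul, hUV]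
    · rw [← Matrix.mul_assoc]
      simpa only [hset] using hlt

theorem exists_zero_or_independent_columns {R E : Type*} [CommRing R] [EuclideanDomain E]
    (φ : R →+* E) (hφ : Function.Surjective φ) {m ι : Type*} [Fintype ι] [DecidableEq ι]
    (P : Matrix m ι R) :
    ∃ U V : Matrix ι ι R, U * V = 1 ∧
      ∀ c : ι → E, (∀ a, ∑ j, φ ((P * U) a j) * c j = 0) →
        ∀ j, (∀ a, φ ((P * U) a j) = 0) ∨ c j = 0 := by
  classical
  -- The set of zero columns can grow only finitely often.
  induction h : {j | ∀ a, φ (P a j) = 0} using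
    (wellFounded_gt (α := Set ι)).induction generalizing P with
  | _ s ih =>
  subst h
  by_cases hP : ∀ c : ι → E, (∀ a, ∑ j, φ (P a j) * c j = 0) →
      ∀ j, (∀ a, φ (P a j) = 0) ∨ c j = 0
  · exact ⟨1, 1, by simp, by simpa using hP⟩
  push Not at hP
  obtain ⟨c, hc, i, hPi, hci⟩ := hP
  obtain ⟨U, V, hUV, hlt⟩ := exists_more_zero_columns φ hφ (c i) P
    (fun j => if ∀ a, φ (P a j) = 0 then 0 else c j)
    (fun a => by
      refine (Finset.sum_congr rfl fun j _ => ?_).trans (hc a)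
      split_ifs with h
      · rw [h a, zero_mul, zero_mul]
      · rfl) i (if_neg (by push Not; exact hPi)) hci hPi (fun j hj => if_pos hj)
  obtain ⟨U', V', hUV', h⟩ := ih _ hlt (P * U) rfl
  refine ⟨U * U', V' * V, ?_, ?_⟩
  · rw [Matrix.mul_assoc, ← Matrix.mul_assoc U', hUV', Matrix.one_mul, hUV]
  · rwa [← Matrix.mul_assoc]

/-- If a prime `p` has a Euclidean residue ring, it can be cancelled from a factorization of
`p • B` without changing the inner dimension. -/
theorem exists_factorization_of_smul_eq_mul {R E : Type*} [CommRing R] [IsDomain R]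
    [EuclideanDomain E] (φ : R →+* E) (hφ : Function.Surjective φ) {p : R} (hp : p ≠ 0)
    (hker : ∀ x, φ x = 0 ↔ p ∣ x) {m n ι : Type*} [Fintype ι] [DecidableEq ι]
    {B : Matrix m n R} {P : Matrix m ι R} {Q : Matrix ι n R} (h : p • B = P * Q) :
    ∃ (P' : Matrix m ι R) (Q' : Matrix ι n R), B = P' * Q' := by
  classical
  obtain ⟨U, V, hUV, hind⟩ := exists_zero_or_independent_columns φ hφ P
  have h' : p • B = (P * U) * (V * Q) := by
    rw [Matrix.mul_assoc, ← Matrix.mul_assoc U, hUV, Matrix.one_mul, h]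
  generalize P * U = P₁ at *
  generalize V * Q = Q₁ at *
  have hB : ∀ a b, p * B a b = ∑ j, P₁ a j * Q₁ j b := fun a b => by
    rw [← Matrix.mul_apply, ← h']; rfl
  have hdvd : ∀ j, (∀ a, p ∣ P₁ a j) ∨ ∀ b, p ∣ Q₁ j b := by
    intro j
    by_contra! hj
    obtain ⟨⟨a, ha⟩, b, hb⟩ := hj
    -- Column `b` of `Q₁` mod `p` is a relation among the columns of `P₁` mod `p`.
    rcases hind (fun j => φ (Q₁ j b)) (fun a => by
      simp only [← map_mul, ← map_sum, ← hB]
      exact (hker _).2 (dvd_mul_right _ _)) j with h | h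
    · exact ha ((hker _).1 (h a))
    · exact hb ((hker _).1 h)
  have hsplit : ∀ j, ∃ (u : m → R) (v : n → R), ∀ a b, P₁ a j * Q₁ j b = p * (u a * v b) := by
    intro j
    rcases hdvd j with h | h <;> choose d hd using h
    · exact ⟨d, Q₁ j, fun a b => by rw [hd, mul_assoc]⟩
    · exact ⟨fun a => P₁ a j, d, fun a b => by rw [hd]; ring⟩
  choose u v huv using hsplit
  refine ⟨Matrix.of fun a j => u j a, Matrix.of v, ?_⟩
  ext a b
  apply mul_left_cancel₀ hp
  rw [hB, Matrix.mul_apply, Finset.mul_sum]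
  exact Finset.sum_congr rfl fun j _ => huv j a b

theorem exists_factorization_of_C_smul_eq_mul {D : Type*} [CommRing D] [IsDomain D]
    [IsPrincipalIdealRing D] {m n ι : Type*} [Fintype ι] {s : D} (hs : s ≠ 0)
    {A : Matrix m n D[X]} {P : Matrix m ι D[X]} {Q : Matrix ι n D[X]}
    (h : C s • A = P * Q) :
    ∃ (P' : Matrix m ι D[X]) (Q' : Matrix ι n D[X]), A = P' * Q' := by
  classical
  induction s using UniqueFactorizationMonoid.induction_on_prime generalizing A P Q with
  | h₁ => exact absurd rfl hs
  | h₂ u hu =>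
    obtain ⟨u, rfl⟩ := hu
    refine ⟨C (↑u⁻¹ : D) • P, Q, ?_⟩
    rw [Matrix.smul_mul, ← h, smul_smul, ← C_mul]
    simp
  | h₃ s p hs0 hp ih =>
    have : (Ideal.span {p}).IsMaximal :=
      PrincipalIdealRing.isMaximal_of_irreducible hp.irreducible
    let := Ideal.Quotient.field (Ideal.span {p})
    rw [C_mul, mul_smul] at h
    obtain ⟨P', Q', h'⟩ := exists_factorization_of_smul_eq_mul
      (mapRingHom (Ideal.Quotient.mk (Ideal.span {p})))
      (map_surjective _ Ideal.Quotient.mk_surjective) (p := C p) (by simpa using hp.ne_zero)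
      (fun x => by
        simp [C_dvd_iff_dvd_coeff, Polynomial.ext_iff, Ideal.Quotient.eq_zero_iff_mem,
          Ideal.mem_span_singleton]) h
    exact ih hs0 h'

/-! ### Minors and rank over a field -/

theorem exists_orderEmbedding_linearIndependent_col {K : Type*} [Field K] {m : Type*} [Finite m]
    {n k : ℕ} (A : Matrix m (Fin n) K) (hk : A.rank = k) :
    ∃ g : Fin k ↪o Fin n, LinearIndependent K (A.submatrix id g).col := by
  classical
  obtain ⟨κ, a, ha, hsp, hli⟩ := exists_linearIndependent' K A.col
  have : Finite κ := Finite.of_injective a ha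
  have := Fintype.ofFinite κ
  have hcard : (Finset.univ.image a).card = k := by
    rw [Finset.card_image_of_injective _ ha, Finset.card_univ, ← hk,
      Matrix.rank_eq_finrank_span_cols, ← hsp, finrank_span_eq_card hli]
  have hg := fun i => Finset.orderEmbOfFin_mem _ hcard i
  simp only [Finset.mem_image, Finset.mem_univ, true_and] at hg
  choose b hb using hg
  refine ⟨Finset.orderEmbOfFin _ hcard, ?_⟩
  have hb_inj : Function.Injective b := fun i j hij =>
    (Finset.orderEmbOfFin _ hcard).injective (by rw [← hb, ← hb, hij])
  have h : (A.submatrix id (Finset.orderEmbOfFin _ hcard)).col = (A.col ∘ a) ∘ b := by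
    ext i j
    simp [Matrix.col, ← hb, Function.comp]
  rw [h]
  exact hli.comp b hb_inj

theorem hasNonzeroMinor_rank {K : Type*} [Field K] {m n : ℕ} (A : Matrix (Fin m) (Fin n) K) :
    HasNonzeroMinor A A.rank := by
  obtain ⟨g, hg⟩ := exists_orderEmbedding_linearIndependent_col A rfl
  have hrank : (A.submatrix id g).transpose.rank = A.rank := by
    rw [LinearIndependent.rank_matrix (M := (A.submatrix id g).transpose) hg, Fintype.card_fin]
  obtain ⟨f, hf⟩ := exists_orderEmbedding_linearIndependent_col _ hrank
  refine ⟨f, g, ?_⟩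
  have := (Matrix.isUnit_iff_isUnit_det _).1 (Matrix.linearIndependent_rows_iff_isUnit.1
    (show LinearIndependent K (A.submatrix f g).row from hf))
  exact this.ne_zero

theorem HasRank.rank_map {R K : Type*} [CommRing R] [Field K] (φ : R →+* K)
    (hφ : Function.Injective φ) {m n r : ℕ} {A : Matrix (Fin m) (Fin n) R} (hA : HasRank A r) :
    (A.map φ).rank = r := by
  have hdet : ∀ (k : ℕ) (f : Fin k ↪o Fin m) (g : Fin k ↪o Fin n),
      ((A.map φ).submatrix f g).det = φ (A.submatrix f g).det := fun k f g => by
    rw [RingHom.map_det]; rfl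
  apply le_antisymm
  · obtain ⟨f, g, h⟩ := hasNonzeroMinor_rank (A.map φ)
    refine hA.2 ⟨f, g, fun h0 => h ?_⟩
    rw [hdet, h0, map_zero]
  · obtain ⟨f, g, h⟩ := hA.1
    have h' : ((A.map φ).submatrix f g).det ≠ 0 := by
      rwa [hdet, Ne, map_eq_zero_iff φ hφ]
    simpa [Matrix.rank_of_det_ne_zero h'] using (A.map φ).rank_submatrix_le f g

/-! ### Factorization over `F[X]` and descent to `D[X]` -/

/-- Over a principal ideal domain `S` every matrix factors with inner dimension its rank. -/
theorem exists_factorization_of_isPrincipalIdealRing {S K : Type*} [CommRing S] [IsDomain S]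
    [IsPrincipalIdealRing S] [Field K] [Algebra S K] [IsFractionRing S K] {m n : Type*}
    [Fintype m] [Fintype n] (A : Matrix m n S) {r : ℕ} (hr : (A.map (algebraMap S K)).rank = r) :
    ∃ (P : Matrix m (Fin r) S) (Q : Matrix (Fin r) n S), A = P * Q := by
  classical
  -- The column module is free; a basis of it gives the columns of `P`. Each of `A` and `P` is a
  -- right multiple of the other, which forces `k = r`.
  obtain ⟨k, b⟩ := Submodule.basisOfPid (Pi.basisFun S m) (Submodule.span S (Set.range A.col))
  have hmem : ∀ j, A.col j ∈ Submodule.span S (Set.range A.col) :=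
    fun j => Submodule.subset_span ⟨j, rfl⟩
  set P : Matrix m (Fin k) S := Matrix.of fun a i => (b i : m → S) a with hP
  have hA : A = P * Matrix.of fun i j => b.repr ⟨A.col j, hmem j⟩ i := by
    ext a j
    have := congrArg (fun v : Submodule.span S (Set.range A.col) => (v : m → S) a)
      (b.sum_repr ⟨A.col j, hmem j⟩)
    simp only [Submodule.coe_sum, Submodule.coe_smul, Finset.sum_apply, Pi.smul_apply,
      smul_eq_mul] at this
    rw [Matrix.mul_apply, ← show A.col j a = A a j from rfl, ← this]
    exact Finset.sum_congr rfl fun i _ => by simp [hP, mul_comm]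
  have hspan : ∀ i, ∃ c : n → S, ∑ j, c j • A.col j = (b i : m → S) := fun i =>
    (Submodule.mem_span_range_iff_exists_fun S).1 (b i).2
  choose c hc using hspan
  have hPA : P = A * Matrix.of fun j i => c i j := by
    ext a i
    simp [hP, ← hc, Matrix.mul_apply, mul_comm]
  have hli : LinearIndependent K (P.map (algebraMap S K)).transpose.row := by
    rw [← LinearIndependent.iff_fractionRing (R := S)]
    have h1 : LinearIndependent S fun i => (b i : m → S) :=
      b.linearIndependent.map' (Submodule.subtype _) (Submodule.ker_subtype _)
    have h2 := h1.map' ((Algebra.linearMap S K).compLeft m) (by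
      rw [LinearMap.ker_eq_bot]
      exact (FaithfulSMul.algebraMap_injective S K).comp_left)
    exact h2
  have hPk : (P.map (algebraMap S K)).rank = k := by
    rw [← Matrix.rank_transpose, hli.rank_matrix, Fintype.card_fin]
  obtain rfl : k = r := by
    rw [← hPk, ← hr]
    apply le_antisymm
    · conv_lhs => rw [hPA, Matrix.map_mul]
      exact Matrix.rank_mul_le_left _ _
    · conv_lhs => rw [hA, Matrix.map_mul]
      exact Matrix.rank_mul_le_left _ _
  exact ⟨P, _, hA⟩

/-- `F[X]` is the localization of `D[X]` at the nonzero constants, so a common denominator can be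
taken in `D`. -/
theorem exists_C_smul_eq_map {D F : Type*} [CommRing D] [IsDomain D] [Field F] [Algebra D F]
    [IsFractionRing D F] {m n : Type*} [Finite m] [Finite n] (P : Matrix m n F[X]) :
    ∃ s : D, s ≠ 0 ∧ ∃ P' : Matrix m n D[X],
      C (algebraMap D F s) • P = P'.map (mapRingHom (algebraMap D F)) := by
  let := Polynomial.algebra D F
  have := Polynomial.isLocalization (nonZeroDivisors D) F
  obtain ⟨⟨_, s, hs, rfl⟩, hb⟩ := IsLocalization.exist_integer_multiples_of_finite
    ((nonZeroDivisors D).map C) (fun x : m × n => P x.1 x.2)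
  choose P' hP' using fun i j => hb (i, j)
  refine ⟨s, nonZeroDivisors.ne_zero hs, Matrix.of P', ?_⟩
  ext1 i j
  have := hP' i j
  rw [Algebra.smul_def] at this
  simpa using this.symm

theorem exists_factorization_of_rank {D : Type*} [CommRing D] [IsDomain D]
    [IsPrincipalIdealRing D] {m n r : ℕ} {A : Matrix (Fin m) (Fin n) D[X]} (hA : HasRank A r) :
    ∃ (P : Matrix (Fin m) (Fin r) D[X]) (Q : Matrix (Fin r) (Fin n) D[X]), A = P * Q := by
  set F := FractionRing D
  set ι := mapRingHom (algebraMap D F)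
  have hι : Function.Injective ι := map_injective _ (IsFractionRing.injective D F)
  obtain ⟨P, Q, h⟩ := exists_factorization_of_isPrincipalIdealRing (K := FractionRing F[X])
    (r := r) (A.map ι) (by
      rw [Matrix.map_map]
      exact hA.rank_map ((algebraMap F[X] (FractionRing F[X])).comp ι)
        ((IsFractionRing.injective F[X] (FractionRing F[X])).comp hι))
  obtain ⟨s, hs, P', hP⟩ := exists_C_smul_eq_map (D := D) P
  obtain ⟨t, ht, Q', hQ⟩ := exists_C_smul_eq_map (D := D) Q
  refine exists_factorization_of_C_smul_eq_mul (mul_ne_zero hs ht) (P := P') (Q := Q') ?_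
  apply Matrix.map_injective hι
  change (C (s * t) • A).map ι = (P' * Q').map ι
  rw [Matrix.map_mul, ← hP, ← hQ, Matrix.smul_mul, Matrix.mul_smul, ← h, smul_smul, ← C_mul,
    ← map_mul]
  ext1 i j
  simp only [Matrix.map_apply, Matrix.smul_apply, smul_eq_mul, map_mul]
  simp [ι]

/-- With inner dimension `r`, an `r × r` minor of `A` is the product of one of `P` and one of `Q`;
larger minors of `P` and `Q` do not exist. -/
theorem IsFullRankFactorization.of_hasRank {R : Type*} [CommRing R] {m n r : ℕ}
    {A : Matrix (Fin m) (Fin n) R} {P : Matrix (Fin m) (Fin r) R} {Q : Matrix (Fin r) (Fin n) R}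
    (hA : HasRank A r) (h : A = P * Q) : IsFullRankFactorization A P Q := by
  obtain ⟨f, g, hfg⟩ := hA.1
  have hdet : (A.submatrix f g).det = (P.submatrix f id).det * (Q.submatrix id g).det := by
    rw [h, ← Matrix.det_mul, ← Matrix.submatrix_mul_equiv P Q f (Equiv.refl _) g]
    rfl
  rw [hdet] at hfg
  exact
    { rank_eq := hA
      left_rank := ⟨⟨f, (OrderIso.refl _).toOrderEmbedding, left_ne_zero_of_mul hfg⟩,
        fun k ⟨_, g', _⟩ => by simpa using Fintype.card_le_of_injective g' g'.injective⟩
      right_rank := ⟨⟨(OrderIso.refl _).toOrderEmbedding, g, right_ne_zero_of_mul hfg⟩,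
        fun k ⟨f', _, _⟩ => by simpa using Fintype.card_le_of_injective f' f'.injective⟩
      eq_mul := h }

theorem proposition2p1 {D : Type*} [CommRing D] [IsDomain D] [IsPrincipalIdealRing D]
    {m n r : ℕ} (A : Matrix (Fin m) (Fin n) D[X]) (hA : HasRank A r) :
    ∃ (P : Matrix (Fin m) (Fin r) D[X]) (Q : Matrix (Fin r) (Fin n) D[X]),
      IsFullRankFactorization A P Q := by
  obtain ⟨P, Q, h⟩ := exists_factorization_of_rank hA
  exact ⟨P, Q, .of_hasRank hA h⟩
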